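/- For $n\in\{2,3\}$ let $n^\omega$ be the space of infinite sequences over $\{0,\dots,n-1\}$, with the uniform (Lebesgue) product measure $\lambda$, $\lambda(\llbracket\sigma\rrbracket)=n^{-|\sigma|}$, where $\llbracket\sigma\rrbracket$ is the set of sequences that extend the finite string $\sigma$. A sequence $x\in n^\omega$ is \emph{Martin-Löf random} if $x\notin\bigcap_i U_i$ for every sequence $(U_i)_{i\in\omega}$ of uniformly $\Sigma^0_1$ (uniformly effectively open) subsets of $n^\omega$ with $\lambda(U_i)\le 2^{-i}$ for all $i$. Let $\sigma_0=\epsilon,\sigma_1=0,\sigma_2=1,\sigma_3=00,\dots$ be the length-lexicographic enumeration of the finite binary strings. For $x\in 3^\omega$ label each nonempty binary string by $\ell_x(\sigma_i)=x(i-1)$, and let $F_x\colon\subseteq 2^\omega\to 2^\omega$ be the partial function for which $F_x(y)$ is the result of removing all $2$'s from the sequence $\ell_x(y\restriction 1),\ell_x(y\restriction 2),\ell_x(y\restriction 3),\dots$; $F_x(y)$ is undefined if only finitely many terms of this sequence differ from $2$. A partial function $F\colon\subseteq 2^\omega\to 2^\omega$ is a \emph{random continuous function} if $F=F_x$ for some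 Martin-Löf random $x\in 3^\omega$. \textbf{Corollary.} For every random continuous function $F$ there is a random continuous function $G$ such that the composition $G\circ F$ is not a random continuous function. Hence the class of random continuous functions is not closed under composition: there are random continuous functions $F$ and $G$ such that $G\circ F$ is not a random continuous function. -/

import Mathlib

namespace RandomFun

/-- The space `n^ω` of infinite sequences over the alphabet `{0, …, n-1}`. -/
abbrev InfSeq (n : ℕ) : Type := ℕ → Fin n

/-- `y ↾ k`, the initial segment of `y` of length `k`. -/
def initSeg {n : ℕ} (y : InfSeq n) (k : ℕ) : List (Fin n) := (List.range k).map y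

/-- `⟦σ⟧`, the set of all sequences that have `σ` as an initial segment. -/
def cylinder {n : ℕ} (σ : List (Fin n)) : Set (InfSeq n) := {y | initSeg y σ.length = σ}

/-- The Lebesgue measure on `n^ω`: the product of the uniform measures on the alphabet. -/
noncomputable def lebesgue (n : ℕ) [NeZero n] : MeasureTheory.Measure (InfSeq n) :=
  MeasureTheory.Measure.infinitePi fun _ : ℕ => (PMF.uniformOfFintype (Fin n)).toMeasure

/-- `(U i)` is a uniformly `Σ⁰₁` sequence: `U i` is the union of the cylinders of the strings
in `W i`, where the set of pairs `(i, σ)` with `σ ∈ W i` is computably enumerable. -/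
def UniformlySigma01 {n : ℕ} (U : ℕ → Set (InfSeq n)) : Prop :=
  ∃ W : ℕ → Set (List (Fin n)),
    REPred (fun p : ℕ × List (Fin n) => p.2 ∈ W p.1) ∧
      ∀ i, U i = ⋃ σ ∈ W i, cylinder σ

/-- Martin-Löf tests for the Lebesgue measure. -/
structure IsMLTest {n : ℕ} [NeZero n] (U : ℕ → Set (InfSeq n)) : Prop where
  sigma : UniformlySigma01 U
  measure_le : ∀ i, lebesgue n (U i) ≤ (2⁻¹ : ENNReal) ^ i

/-- `x` is Martin-Löf random with respect to the Lebesgue measure. -/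
def MLRandom {n : ℕ} [NeZero n] (x : InfSeq n) : Prop :=
  ∀ U : ℕ → Set (InfSeq n), IsMLTest U → x ∉ ⋂ i, U i

/-- The position of a binary string in the length-lexicographic enumeration
`ε, 0, 1, 00, 01, 10, 11, 000, …` (starting with position `0`). The successors `σ0`, `σ1` of the
string at position `m` stand at the positions `2m + 1` and `2m + 2`. -/
def stringIndex (σ : List (Fin 2)) : ℕ := σ.foldl (fun m b => 2 * m + 1 + (b : ℕ)) 0

/-- The label that `x` gives to the nonempty string `σ`: if `σ` is at position `i`, this is the
entry of `x` at `i - 1`. (It is only used at nonempty strings, which have `i ≥ 1`.) -/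
def label (x : InfSeq 3) (σ : List (Fin 2)) : Fin 3 := x (stringIndex σ - 1)

/-- The result of removing all `2`s from `a`. It is defined if infinitely many entries of `a`
differ from `2`, and its `j`-th entry is then the `j`-th entry of `a` that is not `2`. -/
noncomputable def eraseTwos (a : InfSeq 3) : Part (InfSeq 2) where
  Dom := {k | a k ≠ 2}.Infinite
  get h j := (a (Nat.nth (fun k => a k ≠ 2) j)).castLT (by
    have h1 : a (Nat.nth (fun k => a k ≠ 2) j) ≠ 2 := Nat.nth_mem_of_infinite h j
    omega)

/-- The partial function `F_x` on `2^ω` coded by `x`: follow `y` through the labelled binary tree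
and remove the `2`s from the sequence `ℓ_x(y ↾ 1), ℓ_x(y ↾ 2), ℓ_x(y ↾ 3), …`. -/
noncomputable def codedFun (x : InfSeq 3) : InfSeq 2 →. InfSeq 2 :=
  fun y => eraseTwos fun k => label x (initSeg y (k + 1))

/-- Random continuous functions: partial functions on `2^ω` that have a Martin-Löf random code. -/
def IsRandomContinuous (F : InfSeq 2 →. InfSeq 2) : Prop :=
  ∃ x : InfSeq 3, MLRandom x ∧ F = codedFun x

end RandomFun

/-!
On the path `0^ω` the function `F_x` reads only entries of `x` at even positions, and `F_u(0^ω)`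
contains a `1` whenever `u` is random. Given a random `x`, let `w = F_x(0^ω)`, take the odd entries
of `x` as a labelling `y` that is independent of `w`, and replace by `0` every label `1` of `y` on
the path `w`. The resulting labelling `z` is such that `F_z(F_x(0^ω)) = F_z(w)` contains no `1`, so
`F_z ∘ F_x` has no random code.

The labelling `z` is random because its distribution `P` satisfies `P(V)² ≤ 3 λ(V)` for open `V`, so
that a Martin-Löf test that captures `z` pulls back to one that captures `x`. By Cauchy–Schwarz this
bound is about collisions: for two paths that share `k` nodes, the number of pairs of labellings of
length `N` that become equal is at most `(5/3)^k 3^N`. Since independent paths share their first `k`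
nodes with probability `2^(-k)` and `5/6 < 1`, the average of `(5/3)^k` over all pairs of paths is
at most `3`.
-/

namespace RandomFun

open MeasureTheory Filter

section InitSeg

variable {n : ℕ}

@[simp] theorem length_initSeg (y : InfSeq n) (k : ℕ) : (initSeg y k).length = k := by
  simp [initSeg]

theorem initSeg_succ (y : InfSeq n) (k : ℕ) : initSeg y (k + 1) = initSeg y k ++ [y k] := by
  simp [initSeg, List.range_succ]

@[simp] theorem getElem_initSeg (y : InfSeq n) {k j : ℕ} (h : j < (initSeg y k).length) :
    (initSeg y k)[j] = y j := by
  simp [initSeg]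

theorem take_initSeg (y : InfSeq n) (k j : ℕ) :
    (initSeg y k).take j = initSeg y (min j k) := by
  simp [initSeg, ← List.map_take, List.take_range]

theorem ofFn_eq_initSeg (y : InfSeq n) (k : ℕ) :
    (List.ofFn fun i : Fin k => y i) = initSeg y k := by
  apply List.ext_getElem <;> simp [initSeg]

theorem mem_iUnion_cylinder {W : Set (List (Fin n))} {y : InfSeq n} :
    y ∈ ⋃ σ ∈ W, cylinder σ ↔ ∃ k, initSeg y k ∈ W := by
  simp only [Set.mem_iUnion, cylinder, Set.mem_ofPred_eq, exists_prop]
  constructor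
  · rintro ⟨σ, hσ, h⟩
    exact ⟨σ.length, h.symm ▸ hσ⟩
  · rintro ⟨k, hk⟩
    exact ⟨_, hk, by rw [length_initSeg]⟩

theorem measurableSet_iUnion_cylinder (W : Set (List (Fin n))) :
    MeasurableSet (⋃ σ ∈ W, cylinder σ : Set (InfSeq n)) := by
  refine .biUnion W.to_countable fun σ _ => ?_
  have h : Measurable fun (y : InfSeq n) (i : Fin σ.length) => y i := by fun_prop
  convert h (.of_discrete (s := {ρ | List.ofFn ρ = σ})) using 1
  ext y
  simp [cylinder, ofFn_eq_initSeg]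

end InitSeg

section Marginals

variable {n : ℕ} [NeZero n]

instance : IsProbabilityMeasure (lebesgue n) := by
  unfold lebesgue; infer_instance

theorem map_comp_lebesgue {ι : Type*} {e : ι → ℕ} (he : e.Injective) :
    (lebesgue n).map (· ∘ e) =
      Measure.infinitePi fun _ : ι => (PMF.uniformOfFintype (Fin n)).toMeasure :=
  Measure.map_infinitePi_infinitePi_of_inj he

theorem lebesgue_comp_mem {ι : Type*} [Fintype ι] {e : ι → ℕ} (he : e.Injective)
    (S : Finset (ι → Fin n)) :
    lebesgue n {x | x ∘ e ∈ S} = S.card / (n : ENNReal) ^ Fintype.card ι := by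
  have hmeas : Measurable fun x : InfSeq n => x ∘ e := by unfold Function.comp; fun_prop
  have hpoint (c : ι → Fin n) :
      (lebesgue n).map (· ∘ e) {c} = ((n : ENNReal) ^ Fintype.card ι)⁻¹ := by
    rw [map_comp_lebesgue he, Measure.infinitePi_singleton_of_fintype]
    simp [ENNReal.inv_pow]
  calc lebesgue n {x | x ∘ e ∈ S} = (lebesgue n).map (· ∘ e) S :=
        (Measure.map_apply hmeas S.measurableSet).symm
    _ = ∑ c ∈ S, (lebesgue n).map (· ∘ e) {c} := by simp
    _ = S.card / (n : ENNReal) ^ Fintype.card ι := by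
      simp_rw [hpoint, Finset.sum_const, nsmul_eq_mul, div_eq_mul_inv]

end Marginals

section Computes

variable {n m : ℕ}

/-- The string function `r` computes `y` from `x`: it maps the initial segments of `x` to initial
segments of `y` of unbounded length. No monotonicity of `r` is required. -/
structure Computes (r : List (Fin n) → List (Fin m)) (x : InfSeq n) (y : InfSeq m) :
    Prop where
  eq_initSeg : ∀ k, r (initSeg x k) = initSeg y (r (initSeg x k)).length
  tendsto_length : Tendsto (fun k => (r (initSeg x k)).length) atTop atTop

theorem Computes.comp {l : ℕ} {r : List (Fin n) → List (Fin m)} {s : List (Fin m) → List (Fin l)}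
    {x : InfSeq n} {y : InfSeq m} {z : InfSeq l} (hs : Computes s y z) (hr : Computes r x y) :
    Computes (s ∘ r) x z where
  eq_initSeg k := by
    rw [Function.comp_apply, hr.eq_initSeg k, ← hs.eq_initSeg]
  tendsto_length :=
    (hs.tendsto_length.comp hr.tendsto_length).congr fun k => by
      rw [Function.comp_apply, Function.comp_apply, ← hr.eq_initSeg]

/-- The strings whose image under `r`, cut at the first component of the unpaired length, lies in
`W`. Cutting like this lets every initial segment of a computed sequence occur as an image. -/
def pullback (r : List (Fin n) → List (Fin m)) (W : Set (List (Fin m))) : Set (List (Fin n)) :=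
  {σ | (r σ).take σ.length.unpair.1 ∈ W}

theorem Computes.mem_iUnion_pullback {r : List (Fin n) → List (Fin m)} {x : InfSeq n}
    {y : InfSeq m} (h : Computes r x y) (W : Set (List (Fin m))) :
    x ∈ ⋃ σ ∈ pullback r W, cylinder σ ↔ y ∈ ⋃ σ ∈ W, cylinder σ := by
  rw [mem_iUnion_cylinder, mem_iUnion_cylinder]
  simp only [pullback, Set.mem_ofPred_eq, length_initSeg]
  constructor
  · rintro ⟨k, hk⟩
    rw [h.eq_initSeg k, take_initSeg] at hk
    exact ⟨_, hk⟩
  · rintro ⟨j, hj⟩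
    obtain ⟨K, hK⟩ := tendsto_atTop_atTop.1 h.tendsto_length j
    refine ⟨Nat.pair j K, ?_⟩
    rwa [h.eq_initSeg, take_initSeg, Nat.unpair_pair, min_eq_left (hK _ (Nat.right_le_pair j K))]

/-- The entries of `σ` at the positions in the range of `e`. -/
def subword (e : ℕ → ℕ) (σ : List (Fin n)) : List (Fin n) :=
  (List.range σ.length).filterMap fun k => σ[e k]?

theorem primrec_subword {e : ℕ → ℕ} (he : Primrec e) : Primrec (subword e : List (Fin n) → _) :=
  Primrec.listFilterMap (Primrec.list_range.comp Primrec.list_length)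
    (Primrec.list_getElem?.comp Primrec.fst (he.comp Primrec.snd)).to₂

theorem subword_initSeg {e : ℕ → ℕ} (he : StrictMono e) (x : InfSeq n) (N : ℕ) :
    subword e (initSeg x N) = initSeg (x ∘ e) (Nat.count (e · < N) N) := by
  have key (M : ℕ) : (List.range M).filterMap (fun k => (initSeg x N)[e k]?) =
      initSeg (x ∘ e) (Nat.count (e · < N) M) := by
    induction M with
    | zero => simp [initSeg]
    | succ M ih =>
      rw [List.range_succ, List.filterMap_append, ih, Nat.count_succ]
      by_cases hM : e M < N
      · have hall : Nat.count (e · < N) M = M :=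
          Nat.count_iff_forall.2 fun k hk => (he hk).trans hM
        simp [hM, hall, initSeg_succ]
      · simp [hM]
  rw [subword, length_initSeg, key]

theorem Computes.comp_strictMono {e : ℕ → ℕ} (he : StrictMono e) (x : InfSeq n) :
    Computes (subword e) x (x ∘ e) where
  eq_initSeg k := by rw [subword_initSeg he, length_initSeg]
  tendsto_length := by
    refine tendsto_atTop_atTop.2 fun b => ⟨e b, fun N hN => ?_⟩
    rw [subword_initSeg he, length_initSeg]
    calc b = Nat.count (e · < N) b :=
          (Nat.count_iff_forall.2 fun k hk => (he hk).trans_le hN).symm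
      _ ≤ Nat.count (e · < N) N := Nat.count_monotone _ (he.le_apply.trans hN)

end Computes

section Randomness

theorem countable_setOf_rePred {α : Type*} [Primcodable α] :
    {p : α → Prop | REPred p}.Countable := by
  let domain (c : Nat.Partrec.Code) (a : α) : Prop := (c.eval (Encodable.encode a)).Dom
  refine (Set.countable_range domain).mono fun p hp => ?_
  obtain ⟨c, hc⟩ := Nat.Partrec.Code.exists_code.1 hp
  refine ⟨c, funext fun a => ?_⟩
  simp [domain, hc, Part.assert]

variable {n m : ℕ} [NeZero n] [NeZero m]

theorem countable_setOf_isMLTest : {U : ℕ → Set (InfSeq n) | IsMLTest U}.Countable := by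
  refine ((countable_setOf_rePred (α := ℕ × List (Fin n))).image
    fun p i => ⋃ σ ∈ {σ | p (i, σ)}, cylinder σ).mono fun U hU => ?_
  obtain ⟨W, hW, hUW⟩ := hU.sigma
  exact ⟨_, hW, funext fun i => (hUW i).symm⟩

theorem IsMLTest.measure_iInter {U : ℕ → Set (InfSeq n)} (hU : IsMLTest U) :
    lebesgue n (⋂ i, U i) = 0 := by
  have hlim := ENNReal.tendsto_pow_atTop_nhds_zero_of_lt_one (r := 2⁻¹) (by simp)
  exact nonpos_iff_eq_zero.1 <| ge_of_tendsto' hlim fun i =>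
    (measure_mono (Set.iInter_subset U i)).trans (hU.measure_le i)

theorem ae_mlRandom : ∀ᵐ x ∂lebesgue n, MLRandom x := by
  have h : ∀ᵐ x ∂lebesgue n, ∀ U ∈ {U : ℕ → Set (InfSeq n) | IsMLTest U}, x ∉ ⋂ i, U i :=
    (ae_ball_iff countable_setOf_isMLTest).2 fun U hU =>
      measure_eq_zero_iff_ae_notMem.1 (IsMLTest.measure_iInter hU)
  exact h

theorem rePred_comp {α β : Type*} [Primcodable α] [Primcodable β] {p : β → Prop} (hp : REPred p)
    {f : α → β} (hf : Computable f) : REPred fun a => p (f a) :=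
  Partrec.comp hp hf

theorem MLRandom.map {T : InfSeq n → InfSeq m} {r : List (Fin n) → List (Fin m)} {g : ℕ → ℕ}
    (hr : Computable r) (hT : ∀ x, MLRandom x → Computes r x (T x)) (hg : Computable g)
    (hmeas : ∀ i (W : Set (List (Fin m))), lebesgue m (⋃ σ ∈ W, cylinder σ) ≤ 2⁻¹ ^ g i →
      lebesgue n (T ⁻¹' ⋃ σ ∈ W, cylinder σ) ≤ 2⁻¹ ^ i)
    {x : InfSeq n} (hx : MLRandom x) : MLRandom (T x) := by
  intro U hU hmem
  obtain ⟨W, hW, hUW⟩ := hU.sigma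
  refine hx (fun i => ⋃ σ ∈ pullback r (W (g i)), cylinder σ)
    ⟨⟨fun i => pullback r (W (g i)), ?_, fun _ => rfl⟩, fun i => ?_⟩ ?_
  · have hcut : Computable fun p : ℕ × List (Fin n) => (r p.2).take p.2.length.unpair.1 :=
      Primrec.list_take.to_comp.comp
        (Primrec.fst.comp (Primrec.unpair.comp (Primrec.list_length.comp Primrec.snd))).to_comp
        (hr.comp Computable.snd)
    exact rePred_comp hW ((hg.comp Computable.fst).pair hcut)
  · have hae : (⋃ σ ∈ pullback r (W (g i)), cylinder σ : Set (InfSeq n)) ≤ᵐ[lebesgue n]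
        T ⁻¹' ⋃ σ ∈ W (g i), cylinder σ := by
      filter_upwards [ae_mlRandom] with y hy
      exact ((hT y hy).mem_iUnion_pullback _).1
    exact (measure_mono_ae hae).trans (hmeas i _ (hUW (g i) ▸ hU.measure_le (g i)))
  · refine Set.mem_iInter.2 fun i => ((hT x hx).mem_iUnion_pullback _).2 ?_
    exact hUW (g i) ▸ Set.mem_iInter.1 hmem (g i)

theorem MLRandom.comp_strictMono {x : InfSeq n} (hx : MLRandom x) {e : ℕ → ℕ}
    (he : StrictMono e) (he' : Primrec e) : MLRandom (x ∘ e) := by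
  refine hx.map (T := (· ∘ e)) (primrec_subword he').to_comp
    (fun y _ => .comp_strictMono he y) Computable.id fun i W hW => ?_
  have hmeas : Measurable fun y : InfSeq n => y ∘ e := by unfold Function.comp; fun_prop
  rwa [← Measure.map_apply hmeas (measurableSet_iUnion_cylinder W),
    map_comp_lebesgue he.injective]

theorem lebesgue_forall_lt_ne (a : Fin n) (k : ℕ) :
    lebesgue n {x | ∀ j < k, x j ≠ a} = ((n - 1 : ℕ) / n : ENNReal) ^ k := by
  let S : Finset (Fin k → Fin n) := Fintype.piFinset fun _ => {a}ᶜ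
  have hS : {x : InfSeq n | ∀ j < k, x j ≠ a} = {x | x ∘ (Fin.val : Fin k → ℕ) ∈ S} := by
    ext x
    simp [S, Fintype.mem_piFinset, Fin.forall_iff]
  have hcard : S.card = (n - 1) ^ k := by simp [S, Fintype.card_piFinset, Finset.card_compl]
  rw [hS, lebesgue_comp_mem Fin.val_injective, hcard, Fintype.card_fin, div_eq_mul_inv,
    div_eq_mul_inv, mul_pow, ENNReal.inv_pow, Nat.cast_pow]

theorem MLRandom.exists_eq {x : InfSeq n} (hx : MLRandom x) (a : Fin n) : ∃ k, x k = a := by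
  by_contra! hne
  obtain ⟨c, hc⟩ : ∃ c : ℕ, ((n - 1 : ℕ) / n : ENNReal) ^ c < 2⁻¹ := by
    have hlt : ((n - 1 : ℕ) / n : ENNReal) < 1 := by
      refine ENNReal.div_lt_of_lt_mul ?_
      exact_mod_cast (by have := NeZero.pos n; omega : n - 1 < 1 * n)
    exact ((ENNReal.tendsto_pow_atTop_nhds_zero_of_lt_one hlt).eventually_lt_const
      (by simp)).exists
  let W (i : ℕ) : Set (List (Fin n)) := {σ | σ.length = c * i ∧ ∀ b ∈ σ, b ≠ a}
  have hU (i : ℕ) : (⋃ σ ∈ W i, cylinder σ : Set (InfSeq n)) = {y | ∀ j < c * i, y j ≠ a} := by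
    ext y
    rw [mem_iUnion_cylinder]
    simp [W, initSeg]
  have hW : REPred fun p : ℕ × List (Fin n) => p.2 ∈ W p.1 := by
    have hne : PrimrecPred fun b : Fin n => b ≠ a := (Primrec.eq.comp .id (.const a)).not
    exact ComputablePred.to_re (PrimrecPred.computablePred ((Primrec.eq.comp
      (Primrec.list_length.comp .snd) (Primrec.nat_mul.comp (.const c) .fst)).and
        (hne.forall_mem_list.comp .snd)))
  refine hx _ ⟨⟨W, hW, fun _ => rfl⟩, fun i => ?_⟩ (Set.mem_iInter.2 fun i => ?_)
  · rw [hU, lebesgue_forall_lt_ne, pow_mul]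
    gcongr
  · rw [hU]
    exact fun j _ => hne j

theorem MLRandom.infinite_setOf_eq {x : InfSeq n} (hx : MLRandom x) (a : Fin n) :
    {k | x k = a}.Infinite := by
  refine Set.infinite_of_forall_exists_gt fun K => ?_
  have hshift : StrictMono (· + (K + 1)) := fun _ _ h => Nat.add_lt_add_right h (K + 1)
  obtain ⟨k, hk⟩ := (hx.comp_strictMono hshift
    (Primrec.nat_add.comp .id (.const (K + 1)))).exists_eq a
  exact ⟨k + (K + 1), hk, by omega⟩

end Randomness

section EraseTwos

/-- The bit that remains of the label `a` when the label `2` is removed. -/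
def outBit (a : Fin 3) : Option (Fin 2) := if h : (a : ℕ) < 2 then some (a.castLT h) else none

@[simp] theorem outBit_two : outBit 2 = none := rfl

theorem outBit_of_ne_two {a : Fin 3} (h : a ≠ 2) : outBit a = some (a.castLT (by omega)) :=
  dif_pos _

/-- The value of `eraseTwos a` as a total function of `a`. If `Nat.nth` runs out of entries other
than `2`, it returns `0`, and the corresponding bits are meaningless. -/
noncomputable def bitSeq (a : InfSeq 3) : InfSeq 2 :=
  fun j => (outBit (a (Nat.nth (fun k => a k ≠ 2) j))).getD 0

theorem eraseTwos_eq_some_bitSeq {a : InfSeq 3} (h : {k | a k ≠ 2}.Infinite) :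
    eraseTwos a = Part.some (bitSeq a) := by
  refine Part.eq_some_iff.2 ⟨h, funext fun j => ?_⟩
  have hj : a (Nat.nth (fun k => a k ≠ 2) j) ≠ 2 := Nat.nth_mem_of_infinite h j
  simp [bitSeq, eraseTwos, outBit_of_ne_two hj]

theorem exists_eq_one_iff_of_mem_eraseTwos {a : InfSeq 3} {y : InfSeq 2} (h : y ∈ eraseTwos a) :
    (∃ j, y j = 1) ↔ ∃ k, a k = 1 := by
  obtain ⟨hdom, rfl⟩ := h
  simp only [eraseTwos, Fin.ext_iff, Fin.val_castLT]
  constructor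
  · rintro ⟨j, hj⟩
    exact ⟨_, hj⟩
  · rintro ⟨k, hk⟩
    have hk2 : a k ≠ 2 := fun h => by simp [h] at hk
    refine ⟨Nat.count (fun k => a k ≠ 2) k, ?_⟩
    rwa [Nat.nth_count (p := fun k => a k ≠ 2) hk2]

theorem filterMap_outBit_initSeg (a : InfSeq 3) (L : ℕ) :
    (initSeg a L).filterMap outBit = initSeg (bitSeq a) (Nat.count (fun k => a k ≠ 2) L) := by
  induction L with
  | zero => simp [initSeg]
  | succ L ih =>
    rw [initSeg_succ, List.filterMap_append, ih, Nat.count_succ]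
    by_cases hL : a L = 2
    · simp [hL]
    · rw [if_pos hL, initSeg_succ, bitSeq, Nat.nth_count (p := fun k => a k ≠ 2) hL]
      simp [outBit_of_ne_two hL]

theorem computes_bitSeq {a : InfSeq 3} (h : {k | a k ≠ 2}.Infinite) :
    Computes (List.filterMap outBit) a (bitSeq a) where
  eq_initSeg L := by rw [filterMap_outBit_initSeg, length_initSeg]
  tendsto_length := by
    refine tendsto_atTop_atTop.2 fun b => ⟨Nat.nth (fun k => a k ≠ 2) b, fun L hL => ?_⟩
    rw [filterMap_outBit_initSeg, length_initSeg, ← Nat.count_nth_of_infinite h b]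
    exact Nat.count_monotone _ hL

theorem MLRandom.infinite_setOf_ne_two {a : InfSeq 3} (ha : MLRandom a) :
    {k | a k ≠ 2}.Infinite :=
  (ha.infinite_setOf_eq 0).mono fun k (hk : a k = 0) => by simp [hk]

/-- The blocks of `L` labels that put out at least the bits `v`. -/
def prefixBlocks (L : ℕ) (v : List (Fin 2)) : Finset (Fin L → Fin 3) :=
  {σ | v <+: (List.ofFn σ).filterMap outBit}

theorem card_prefixBlocks_succ (L : ℕ) (b : Fin 2) (v : List (Fin 2)) :
    (prefixBlocks (L + 1) (b :: v)).card =
      (prefixBlocks L v).card + (prefixBlocks L (b :: v)).card := by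
  simp only [prefixBlocks, Finset.card_filter]
  rw [← (Fin.consEquiv fun _ => Fin 3).sum_comp, Fintype.sum_prod_type, Fin.sum_univ_three]
  fin_cases b <;> simp [Fin.consEquiv, List.ofFn_succ, outBit, List.cons_prefix_cons]

theorem card_prefixBlocks_mul_le (L : ℕ) (v : List (Fin 2)) :
    (prefixBlocks L v).card * 2 ^ v.length ≤ 3 ^ L := by
  induction L generalizing v with
  | zero => cases v <;> simp [prefixBlocks]
  | succ L ih =>
    cases v with
    | nil => simp [prefixBlocks]
    | cons b v =>
      have hv := ih v
      have hbv := ih (b :: v)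
      rw [List.length_cons, pow_succ] at hbv ⊢
      rw [card_prefixBlocks_succ, pow_succ]
      linarith

variable {e f : ℕ → ℕ}

theorem lebesgue_prefix_filterMap_outBit_le (he : e.Injective) (hf : f.Injective)
    (hef : ∀ i j, e i ≠ f j) (L : ℕ) (v : List (Fin 2)) {N : ℕ} (τ : Fin N → Fin 3) :
    lebesgue 3 {x | v <+: (initSeg (x ∘ e) L).filterMap outBit ∧ (fun n : Fin N => x (f n)) = τ} ≤
      (2 ^ v.length * 3 ^ N)⁻¹ := by
  let ef : Fin L ⊕ Fin N → ℕ := Sum.elim (fun k => e k) fun n => f n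
  have hinj : ef.Injective :=
    (he.comp Fin.val_injective).sumElim (hf.comp Fin.val_injective) fun k n => hef k n
  let S : Finset (Fin L ⊕ Fin N → Fin 3) := (prefixBlocks L v).image (Sum.elim · τ)
  have hS : {x : InfSeq 3 | v <+: (initSeg (x ∘ e) L).filterMap outBit ∧
      (fun n : Fin N => x (f n)) = τ} ⊆ {x | x ∘ ef ∈ S} := by
    rintro x ⟨hv, rfl⟩
    refine Finset.mem_image.2 ⟨fun k => x (e k), ?_, ?_⟩
    · rw [← ofFn_eq_initSeg] at hv
      exact Finset.mem_filter.2 ⟨Finset.mem_univ _, hv⟩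
    · ext (k | n) <;> rfl
  have hcard : S.card * (2 ^ v.length * 3 ^ N) ≤ 3 ^ (L + N) := by
    rw [← mul_assoc, pow_add]
    gcongr
    exact (Nat.mul_le_mul_right _ Finset.card_image_le).trans (card_prefixBlocks_mul_le L v)
  refine (measure_mono hS).trans ?_
  rw [lebesgue_comp_mem hinj, Fintype.card_sum, Fintype.card_fin, Fintype.card_fin]
  refine ENNReal.div_le_of_le_mul ?_
  rw [mul_comm, ← div_eq_mul_inv, ENNReal.le_div_iff_mul_le (by simp) (by simp)]
  exact_mod_cast hcard

theorem lebesgue_bitSeq_le (he : e.Injective) (hf : f.Injective)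
    (hef : ∀ i j, e i ≠ f j) {M N : ℕ} (v : Fin M → Fin 2) (τ : Fin N → Fin 3) :
    lebesgue 3 {x | (fun n : Fin M => bitSeq (x ∘ e) n) = v ∧ (fun n : Fin N => x (f n)) = τ} ≤
      (2 ^ M * 3 ^ N)⁻¹ := by
  let E (L : ℕ) : Set (InfSeq 3) :=
    {x | List.ofFn v <+: (initSeg (x ∘ e) L).filterMap outBit ∧ (fun n : Fin N => x (f n)) = τ}
  have hmono : Monotone E := fun L L' hL x hx => by
    refine ⟨hx.1.trans (List.IsPrefix.filterMap outBit ?_), hx.2⟩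
    rw [← min_eq_left hL, ← take_initSeg]
    exact List.take_prefix _ _
  have hinf : ∀ᵐ x ∂lebesgue 3, {k | (x ∘ e) k ≠ 2}.Infinite := by
    have hmeas : Measurable fun x : InfSeq 3 => x ∘ e := by unfold Function.comp; fun_prop
    refine ae_of_ae_map hmeas.aemeasurable (p := fun a => {k | a k ≠ 2}.Infinite) ?_
    rw [map_comp_lebesgue he]
    exact ae_mlRandom.mono fun _ ha => ha.infinite_setOf_ne_two
  have hae : {x : InfSeq 3 | (fun n : Fin M => bitSeq (x ∘ e) n) = v ∧
      (fun n : Fin N => x (f n)) = τ} ≤ᵐ[lebesgue 3] ⋃ L, E L := by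
    filter_upwards [hinf] with x hx
    rintro ⟨rfl, hτ⟩
    have hw := computes_bitSeq hx
    obtain ⟨L, hL⟩ := (hw.tendsto_length.eventually_ge_atTop M).exists
    refine Set.mem_iUnion.2 ⟨L, ?_, hτ⟩
    rw [ofFn_eq_initSeg, hw.eq_initSeg L, ← min_eq_left hL, ← take_initSeg]
    exact List.take_prefix _ _
  calc _ ≤ lebesgue 3 (⋃ L, E L) := measure_mono_ae hae
    _ = ⨆ L, lebesgue 3 (E L) := hmono.measure_iUnion
    _ ≤ (2 ^ M * 3 ^ N)⁻¹ := iSup_le fun L => by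
      simpa using lebesgue_prefix_filterMap_outBit_le he hf hef L (List.ofFn v) τ

end EraseTwos

section StringIndex

theorem stringIndex_concat (σ : List (Fin 2)) (b : Fin 2) :
    stringIndex (σ ++ [b]) = 2 * stringIndex σ + 1 + b := by
  simp [stringIndex]

theorem length_le_stringIndex (σ : List (Fin 2)) : σ.length ≤ stringIndex σ := by
  induction σ using List.reverseRecOn with
  | nil => simp
  | append_singleton σ b ih =>
    rw [stringIndex_concat, List.length_append, List.length_singleton]
    omega

theorem stringIndex_eq_zero_iff {σ : List (Fin 2)} : stringIndex σ = 0 ↔ σ = [] := by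
  refine ⟨fun h => List.eq_nil_of_length_eq_zero ?_, fun h => by simp [h, stringIndex]⟩
  exact Nat.eq_zero_of_le_zero (h ▸ length_le_stringIndex σ)

theorem stringIndex_injective : stringIndex.Injective := by
  intro σ
  induction σ using List.reverseRecOn with
  | nil => exact fun τ h => (stringIndex_eq_zero_iff.1 (h.symm.trans rfl)).symm
  | append_singleton σ b ih =>
    intro τ h
    cases τ using List.reverseRecOn with
    | nil => exact stringIndex_eq_zero_iff.1 (h.trans rfl)
    | append_singleton τ c =>
      rw [stringIndex_concat, stringIndex_concat] at h
      obtain rfl : b = c := by omega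
      rw [ih (by omega : stringIndex σ = stringIndex τ)]

end StringIndex

section CommonLength

/-- The length of the longest common prefix of two binary strings. -/
def commonLength : List (Fin 2) → List (Fin 2) → ℕ
  | a :: v, b :: w => if a = b then commonLength v w + 1 else 0
  | _, _ => 0

theorem length_le_commonLength {σ v w : List (Fin 2)} (hv : σ <+: v) (hw : σ <+: w) :
    σ.length ≤ commonLength v w := by
  induction σ generalizing v w with
  | nil => simp
  | cons a σ ih =>
    obtain ⟨v', rfl⟩ := hv
    obtain ⟨w', rfl⟩ := hw
    simpa [commonLength] using ih (List.prefix_append σ v') (List.prefix_append σ w')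

theorem sum_pow_commonLength_succ (N : ℕ) (c : ℝ) :
    ∑ v : Fin (N + 1) → Fin 2, ∑ w : Fin (N + 1) → Fin 2,
        c ^ commonLength (List.ofFn v) (List.ofFn w) =
      2 * c * (∑ v : Fin N → Fin 2, ∑ w : Fin N → Fin 2,
        c ^ commonLength (List.ofFn v) (List.ofFn w)) + 2 * 4 ^ N := by
  have h4 : (4 : ℝ) ^ N = 2 ^ N * 2 ^ N := by rw [← mul_pow]; norm_num
  simp_rw [← (Fin.consEquiv fun _ : Fin (N + 1) => Fin 2).sum_comp]
  simp only [Fintype.sum_prod_type, Fin.sum_univ_two, Fin.consEquiv, Equiv.coe_fn_mk,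
    List.ofFn_succ, Fin.cons_zero, Fin.cons_succ, commonLength, if_true, zero_ne_one, one_ne_zero,
    if_false, pow_zero, Finset.sum_add_distrib, pow_succ, ← Finset.sum_mul, Finset.sum_const,
    Finset.card_univ, Fintype.card_pi, Fintype.card_fin, Finset.prod_const, nsmul_eq_mul]
  rw [h4]
  push_cast
  ring

theorem sum_five_thirds_pow_commonLength_le (N : ℕ) :
    ∑ v : Fin N → Fin 2, ∑ w : Fin N → Fin 2,
      (5 / 3 : ℝ) ^ commonLength (List.ofFn v) (List.ofFn w) ≤ 3 * 4 ^ N := by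
  induction N with
  | zero => simp [commonLength]
  | succ N ih =>
    rw [sum_pow_commonLength_succ, pow_succ]
    linarith

end CommonLength

section Edit

/-- The string at position `n + 1` of the length-lexicographic enumeration is a prefix of `w`, that
is, the label `n` of the tree lies on the path `w`. -/
def OnPath (w : List (Fin 2)) (n : ℕ) : Prop := ∃ τ ∈ w.inits, stringIndex τ = n + 1

instance (w : List (Fin 2)) (n : ℕ) : Decidable (OnPath w n) :=
  inferInstanceAs (Decidable (∃ τ ∈ w.inits, stringIndex τ = n + 1))

theorem onPath_iff_exists_prefix {w : List (Fin 2)} {n : ℕ} :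
    OnPath w n ↔ ∃ τ, τ <+: w ∧ stringIndex τ = n + 1 := by
  simp [OnPath]

theorem onPath_iff_exists_take {w : List (Fin 2)} {n : ℕ} :
    OnPath w n ↔ ∃ k < n + 2, stringIndex (w.take k) = n + 1 := by
  rw [onPath_iff_exists_prefix]
  constructor
  · rintro ⟨τ, hτ, hn⟩
    have hlen := length_le_stringIndex τ
    exact ⟨τ.length, by omega, by rwa [← List.prefix_iff_eq_take.1 hτ]⟩
  · rintro ⟨k, -, hk⟩
    exact ⟨_, List.take_prefix k w, hk⟩

/-- The label `n` of the tree, when its old value is `a`, after every label `1` on the path `w` has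
been replaced by `0`. -/
def editLabel (w : List (Fin 2)) (n : ℕ) (a : Fin 3) : Fin 3 :=
  if OnPath w n ∧ a = 1 then 0 else a

/-- The labelling `y` of the tree with every label `1` on the path `w` replaced by `0`. -/
def editAlong (w : InfSeq 2) (y : InfSeq 3) : InfSeq 3 :=
  fun n => editLabel (initSeg w (n + 1)) n (y n)

theorem editLabel_initSeg (w : InfSeq 2) {n N : ℕ} (h : n < N) (a : Fin 3) :
    editLabel (initSeg w N) n a = editLabel (initSeg w (n + 1)) n a := by
  have hpath : OnPath (initSeg w N) n ↔ OnPath (initSeg w (n + 1)) n := by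
    simp only [onPath_iff_exists_take, take_initSeg]
    refine exists_congr fun k => and_congr_right fun hk => ?_
    rw [min_eq_left (by omega), min_eq_left (by omega)]
  simp only [editLabel, hpath]

theorem label_editAlong_ne_one (w : InfSeq 2) (y : InfSeq 3) (k : ℕ) :
    label (editAlong w y) (initSeg w (k + 1)) ≠ 1 := by
  set n := stringIndex (initSeg w (k + 1)) - 1 with hn
  have hlen := length_le_stringIndex (initSeg w (k + 1))
  rw [length_initSeg] at hlen
  have hpath : OnPath (initSeg w (n + 1)) n := by
    refine onPath_iff_exists_take.2 ⟨k + 1, by omega, ?_⟩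
    rw [take_initSeg, min_eq_left (by omega)]
    omega
  rw [label, ← hn, editAlong, editLabel]
  split_ifs with h
  · decide
  · exact fun h1 => h ⟨hpath, h1⟩

/-- `editAlong` on strings; the result is only as long as both arguments allow. -/
def editString (w : List (Fin 2)) (τ : List (Fin 3)) : List (Fin 3) :=
  (List.range (min w.length τ.length)).map fun n => editLabel w n (τ.getD n 0)

theorem editString_initSeg (w : InfSeq 2) (y : InfSeq 3) (M N : ℕ) :
    editString (initSeg w M) (initSeg y N) = initSeg (editAlong w y) (min M N) := by
  rw [editString, length_initSeg, length_initSeg]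
  refine List.map_congr_left fun n hn => ?_
  obtain ⟨hM, hN⟩ := lt_min_iff.1 (List.mem_range.1 hn)
  simp [editLabel_initSeg w hM, editAlong, hN]

theorem Computes.editAlong {n : ℕ} {r : List (Fin n) → List (Fin 2)}
    {s : List (Fin n) → List (Fin 3)} {x : InfSeq n} {w : InfSeq 2} {y : InfSeq 3}
    (hr : Computes r x w) (hs : Computes s x y) :
    Computes (fun σ => editString (r σ) (s σ)) x (editAlong w y) where
  eq_initSeg k := by
    rw [hr.eq_initSeg k, hs.eq_initSeg k, editString_initSeg, length_initSeg]
  tendsto_length := by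
    refine tendsto_atTop.2 fun b => ?_
    filter_upwards [hr.tendsto_length.eventually_ge_atTop b,
      hs.tendsto_length.eventually_ge_atTop b] with k hrk hsk
    simp [editString, hrk, hsk]

end Edit

section Collisions

theorem sq_card_filter_mem_le {α β : Type*} [Fintype α] [DecidableEq β] (f : α → β)
    (S : Finset β) :
    (Finset.univ.filter (f · ∈ S)).card ^ 2 ≤
      S.card * (Finset.univ.filter fun p : α × α => f p.1 = f p.2).card := by
  have hfiber : (Finset.univ.filter (f · ∈ S)).card =
      ∑ b ∈ S, (Finset.univ.filter (f · = b)).card :=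
    (Finset.sum_card_fiberwise_eq_card_filter _ _ _).symm
  have hpairs (b : β) : (Finset.univ.filter (f · = b)).card ^ 2 =
      (Finset.univ.filter fun p : α × α => f p.1 = f p.2 ∧ f p.1 = b).card := by
    rw [sq, ← Finset.card_product, ← Finset.filter_product]
    congr 1
    ext p
    simp only [Finset.mem_filter]
    grind
  calc (Finset.univ.filter (f · ∈ S)).card ^ 2
      ≤ S.card * ∑ b ∈ S, (Finset.univ.filter (f · = b)).card ^ 2 := by
        rw [hfiber]
        exact sq_sum_le_card_mul_sum_sq
    _ = S.card * (Finset.univ.filter fun p : α × α => f p.1 = f p.2 ∧ f p.1 ∈ S).card := by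
        simp_rw [hpairs, ← Finset.filter_filter]
        rw [Finset.sum_card_fiberwise_eq_card_filter]
    _ ≤ S.card * (Finset.univ.filter fun p : α × α => f p.1 = f p.2).card := by
      gcongr with p
      exact And.left

/-- `editAlong` on blocks of length `N`. -/
def editBlock {N : ℕ} (w : Fin N → Fin 2) (τ : Fin N → Fin 3) : Fin N → Fin 3 :=
  fun n => editLabel (List.ofFn w) n (τ n)

theorem editAlong_eq_editBlock (w : InfSeq 2) (y : InfSeq 3) (N : ℕ) :
    (fun n : Fin N => editAlong w y n) = editBlock (fun n => w n) (fun n => y n) := by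
  funext n
  rw [editBlock, ofFn_eq_initSeg, editLabel_initSeg w n.2, editAlong]

theorem card_editLabel_eq_editLabel (v w : List (Fin 2)) (n : ℕ) :
    (Finset.univ.filter fun q : Fin 3 × Fin 3 => editLabel v n q.1 = editLabel w n q.2).card =
      if OnPath v n ∧ OnPath w n then 5 else 3 := by
  by_cases hv : OnPath v n <;> by_cases hw : OnPath w n <;>
    simp only [editLabel, hv, hw, true_and, false_and, and_true, and_false, if_true, if_false] <;>
    rfl

theorem card_onPath_le_commonLength (N : ℕ) (v w : List (Fin 2)) :
    (Finset.univ.filter fun n : Fin N => OnPath v n ∧ OnPath w n).card ≤ commonLength v w := by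
  have hsub : (Finset.univ.filter fun n : Fin N => OnPath v n ∧ OnPath w n).image
      (fun n : Fin N => (n : ℕ) + 1) ⊆
      (Finset.Icc 1 (commonLength v w)).image fun k => stringIndex (v.take k) := by
    intro m hm
    simp only [Finset.mem_image, Finset.mem_filter, Finset.mem_univ, true_and] at hm
    obtain ⟨n, ⟨hv, hw⟩, rfl⟩ := hm
    obtain ⟨τ, hτv, hτ⟩ := onPath_iff_exists_prefix.1 hv
    obtain ⟨τ', hτw, hτ'⟩ := onPath_iff_exists_prefix.1 hw
    obtain rfl : τ = τ' := stringIndex_injective (hτ.trans hτ'.symm)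
    have hne : τ ≠ [] := fun h => by simp [stringIndex_eq_zero_iff.2 h] at hτ
    refine Finset.mem_image.2 ⟨τ.length, Finset.mem_Icc.2
      ⟨List.length_pos_iff.2 hne, length_le_commonLength hτv hτw⟩, ?_⟩
    rw [← List.prefix_iff_eq_take.1 hτv, hτ]
  have hinj : Function.Injective fun n : Fin N => (n : ℕ) + 1 :=
    fun a b h => Fin.ext (Nat.succ_injective h)
  calc _ = _ := (Finset.card_image_of_injective _ hinj).symm
    _ ≤ _ := Finset.card_le_card hsub
    _ ≤ commonLength v w := Finset.card_image_le.trans (by simp)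

theorem card_editBlock_eq_editBlock_le {N : ℕ} (v w : Fin N → Fin 2) :
    ((Finset.univ.filter fun q : (Fin N → Fin 3) × (Fin N → Fin 3) =>
      editBlock v q.1 = editBlock w q.2).card : ℝ) ≤
      3 ^ N * (5 / 3) ^ commonLength (List.ofFn v) (List.ofFn w) := by
  let C (n : Fin N) : Finset (Fin 3 × Fin 3) :=
    {q | editLabel (List.ofFn v) n q.1 = editLabel (List.ofFn w) n q.2}
  have hprod : (Finset.univ.filter fun q : (Fin N → Fin 3) × (Fin N → Fin 3) =>
      editBlock v q.1 = editBlock w q.2).card = ∏ n, (C n).card := by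
    rw [← Fintype.card_piFinset]
    refine Finset.card_equiv (Equiv.arrowProdEquivProdArrow (Fin N) (fun _ => Fin 3)
      (fun _ => Fin 3)).symm fun q => ?_
    simp [C, funext_iff, editBlock, Equiv.arrowProdEquivProdArrow]
  have hC (n : Fin N) : ((C n).card : ℝ) =
      3 * if OnPath (List.ofFn v) n ∧ OnPath (List.ofFn w) n then 5 / 3 else 1 := by
    rw [card_editLabel_eq_editLabel]
    split_ifs <;> norm_num
  rw [hprod, Nat.cast_prod]
  simp_rw [hC, Finset.prod_mul_distrib, Finset.prod_ite]
  simp only [Finset.prod_const, Finset.card_univ, Fintype.card_fin, one_pow, mul_one]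
  gcongr
  · norm_num
  · exact card_onPath_le_commonLength N _ _

theorem card_collisions_editBlock_le (N : ℕ) :
    (Finset.univ.filter fun p : ((Fin N → Fin 2) × (Fin N → Fin 3)) ×
      ((Fin N → Fin 2) × (Fin N → Fin 3)) =>
        editBlock p.1.1 p.1.2 = editBlock p.2.1 p.2.2).card ≤ 3 * 12 ^ N := by
  have hsum : (Finset.univ.filter fun p : ((Fin N → Fin 2) × (Fin N → Fin 3)) ×
      ((Fin N → Fin 2) × (Fin N → Fin 3)) =>
        editBlock p.1.1 p.1.2 = editBlock p.2.1 p.2.2).card =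
      ∑ v : Fin N → Fin 2, ∑ w : Fin N → Fin 2,
        (Finset.univ.filter fun q : (Fin N → Fin 3) × (Fin N → Fin 3) =>
          editBlock v q.1 = editBlock w q.2).card := by
    simp only [Finset.card_filter, Fintype.sum_prod_type]
    exact Finset.sum_congr rfl fun v _ => Finset.sum_comm
  suffices h : (∑ v : Fin N → Fin 2, ∑ w : Fin N → Fin 2,
      ((Finset.univ.filter fun q : (Fin N → Fin 3) × (Fin N → Fin 3) =>
        editBlock v q.1 = editBlock w q.2).card : ℝ)) ≤ 3 * 12 ^ N by
    rw [hsum]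
    exact_mod_cast h
  calc _ ≤ ∑ v : Fin N → Fin 2, ∑ w : Fin N → Fin 2,
        3 ^ N * (5 / 3 : ℝ) ^ commonLength (List.ofFn v) (List.ofFn w) := by
        gcongr with v _ w _
        exact card_editBlock_eq_editBlock_le v w
    _ ≤ 3 ^ N * (3 * 4 ^ N) := by
        simp_rw [← Finset.mul_sum]
        gcongr
        exact sum_five_thirds_pow_commonLength_le N
    _ = 3 * 12 ^ N := by
        rw [mul_left_comm, ← mul_pow]
        norm_num

theorem sq_card_editBlock_mem_le {N : ℕ} (S : Finset (Fin N → Fin 3)) :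
    (Finset.univ.filter fun p : (Fin N → Fin 2) × (Fin N → Fin 3) =>
      editBlock p.1 p.2 ∈ S).card ^ 2 ≤ S.card * (3 * 12 ^ N) := by
  have h := sq_card_filter_mem_le
    (fun p : (Fin N → Fin 2) × (Fin N → Fin 3) => editBlock p.1 p.2) S
  have hcoll := card_collisions_editBlock_le N
  exact h.trans (Nat.mul_le_mul_left S.card hcoll)

end Collisions

section SecondMoment

variable {Ω : Type*} {w : Ω → InfSeq 2} {y : Ω → InfSeq 3} [MeasurableSpace Ω] {μ : Measure Ω}

theorem sq_measure_editAlong_mem_le {N : ℕ}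
    (h : ∀ (v : Fin N → Fin 2) (τ : Fin N → Fin 3),
      μ {ω | (fun n : Fin N => w ω n) = v ∧ (fun n : Fin N => y ω n) = τ} ≤ (2 ^ N * 3 ^ N)⁻¹)
    (S : Finset (Fin N → Fin 3)) :
    μ {ω | (fun n : Fin N => editAlong (w ω) (y ω) n) ∈ S} ^ 2 ≤
      3 * lebesgue 3 {z | z ∘ Fin.val ∈ S} := by
  let P : Finset ((Fin N → Fin 2) × (Fin N → Fin 3)) := {p | editBlock p.1 p.2 ∈ S}
  have hsub : {ω | (fun n : Fin N => editAlong (w ω) (y ω) n) ∈ S} ⊆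
      ⋃ p ∈ P, {ω | (fun n : Fin N => w ω n) = p.1 ∧ (fun n : Fin N => y ω n) = p.2} := by
    intro ω hω
    rw [Set.mem_ofPred_eq, editAlong_eq_editBlock] at hω
    exact Set.mem_biUnion (Finset.mem_filter.2 ⟨Finset.mem_univ (_, _), hω⟩) ⟨rfl, rfl⟩
  have hle : μ {ω | (fun n : Fin N => editAlong (w ω) (y ω) n) ∈ S} ≤ P.card / (2 ^ N * 3 ^ N) :=
    calc _ ≤ ∑ p ∈ P, μ {ω | (fun n : Fin N => w ω n) = p.1 ∧ (fun n : Fin N => y ω n) = p.2} :=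
          (measure_mono hsub).trans (measure_biUnion_finset_le _ _)
      _ ≤ ∑ _p ∈ P, (2 ^ N * 3 ^ N)⁻¹ := Finset.sum_le_sum fun p _ => h p.1 p.2
      _ = P.card / (2 ^ N * 3 ^ N) := by rw [Finset.sum_const, nsmul_eq_mul, div_eq_mul_inv]
  have hP : (P.card : ENNReal) ^ 2 ≤ S.card * (3 * 12 ^ N) := by
    exact_mod_cast sq_card_editBlock_mem_le S
  rw [lebesgue_comp_mem Fin.val_injective, Fintype.card_fin]
  calc _ ≤ (P.card / (2 ^ N * 3 ^ N) : ENNReal) ^ 2 := by gcongr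
    _ = (P.card : ENNReal) ^ 2 / (12 ^ N * 3 ^ N) := by
      have h36 : ((2 : ENNReal) ^ N * 3 ^ N) ^ 2 = 12 ^ N * 3 ^ N := by
        rw [← mul_pow, ← mul_pow, ← pow_mul, mul_comm N, pow_mul]
        norm_num
      rw [div_eq_mul_inv, mul_pow, ← ENNReal.inv_pow, h36, ← div_eq_mul_inv]
    _ ≤ S.card * (3 * 12 ^ N) / (12 ^ N * 3 ^ N) := by gcongr
    _ = 3 * (S.card / 3 ^ N) := by
      rw [mul_comm (12 ^ N) (3 ^ N), ← mul_assoc,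
        ENNReal.mul_div_mul_right _ _ (by positivity) (by simp), mul_comm, mul_div_assoc]

theorem sq_measure_editAlong_le
    (h : ∀ (N : ℕ) (v : Fin N → Fin 2) (τ : Fin N → Fin 3),
      μ {ω | (fun n : Fin N => w ω n) = v ∧ (fun n : Fin N => y ω n) = τ} ≤ (2 ^ N * 3 ^ N)⁻¹)
    (W : Set (List (Fin 3))) :
    μ {ω | editAlong (w ω) (y ω) ∈ ⋃ σ ∈ W, cylinder σ} ^ 2 ≤
      3 * lebesgue 3 (⋃ σ ∈ W, cylinder σ) := by
  classical
  let S (N : ℕ) : Finset (Fin N → Fin 3) := {ρ | ∃ k ≤ N, (List.ofFn ρ).take k ∈ W}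
  have hS (N : ℕ) (z : InfSeq 3) : (fun n : Fin N => z n) ∈ S N ↔ ∃ k ≤ N, initSeg z k ∈ W := by
    simp only [S, Finset.mem_filter, Finset.mem_univ, true_and, ofFn_eq_initSeg, take_initSeg]
    exact exists_congr fun k => and_congr_right fun hk => by rw [min_eq_left hk]
  let E (N : ℕ) : Set Ω := {ω | ∃ k ≤ N, initSeg (editAlong (w ω) (y ω)) k ∈ W}
  have hE : {ω | editAlong (w ω) (y ω) ∈ ⋃ σ ∈ W, cylinder σ} = ⋃ N, E N := by
    ext ω
    rw [Set.mem_ofPred_eq, mem_iUnion_cylinder, Set.mem_iUnion]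
    exact ⟨fun ⟨k, hk⟩ => ⟨k, k, le_rfl, hk⟩, fun ⟨_, k, _, hk⟩ => ⟨k, hk⟩⟩
  have hmono : Monotone E := fun M N hMN ω ⟨k, hk, hkW⟩ => ⟨k, hk.trans hMN, hkW⟩
  rw [hE, hmono.measure_iUnion, ENNReal.iSup_pow]
  refine iSup_le fun N => ?_
  calc μ (E N) ^ 2 ≤ 3 * lebesgue 3 {z | z ∘ Fin.val ∈ S N} := by
        simpa only [hS] using sq_measure_editAlong_mem_le (h N) (S N)
    _ ≤ 3 * lebesgue 3 (⋃ σ ∈ W, cylinder σ) := by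
        gcongr
        intro z hz
        obtain ⟨k, -, hk⟩ := (hS N z).1 hz
        exact mem_iUnion_cylinder.2 ⟨k, hk⟩

end SecondMoment

section Computability

theorem primrec_stringIndex : Primrec stringIndex :=
  (Primrec.list_foldl (h := fun _ (p : ℕ × Fin 2) => 2 * p.1 + 1 + (p.2 : ℕ)) .id (.const 0)
    (Primrec.nat_add.comp (Primrec.succ.comp (Primrec.nat_mul.comp (.const 2)
      (Primrec.fst.comp .snd))) (Primrec.fin_val.comp (Primrec.snd.comp .snd)))).of_eq fun σ => by
    simp [stringIndex, ← List.map_eq_flatMap, List.foldl_map]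

theorem primrecPred_onPath : PrimrecPred fun p : List (Fin 2) × ℕ => OnPath p.1 p.2 := by
  have hnode : PrimrecRel fun (k : ℕ) (p : List (Fin 2) × ℕ) =>
      stringIndex (p.1.take k) = p.2 + 1 :=
    Primrec.eq.comp
      (primrec_stringIndex.comp (Primrec.list_take.comp .fst (Primrec.fst.comp .snd)))
      (Primrec.succ.comp (Primrec.snd.comp .snd))
  have hbound : Primrec fun p : List (Fin 2) × ℕ => List.range (p.2 + 2) :=
    Primrec.list_range.comp (Primrec.nat_add.comp .snd (.const 2))
  exact (hnode.exists_mem_list.comp hbound .id).of_eq fun p => by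
    simp [onPath_iff_exists_take]

theorem primrec₂_editString : Primrec₂ editString := by
  have hlabel : Primrec fun p : (List (Fin 2) × List (Fin 3)) × ℕ => p.1.2.getD p.2 0 :=
    (Primrec.list_getD 0).comp (Primrec.snd.comp .fst) .snd
  refine Primrec.list_map (Primrec.list_range.comp (Primrec.nat_min.comp
    (Primrec.list_length.comp .fst) (Primrec.list_length.comp .snd))) ?_
  exact Primrec.ite ((primrecPred_onPath.comp ((Primrec.fst.comp .fst).pair .snd)).and
    (Primrec.eq.comp hlabel (.const 1))) (.const 0) hlabel

end Computability

section ZeroPath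

/-- The position of the label of the string `0 ^ (k + 1)`; the subtraction does not truncate. -/
def zeroPos (k : ℕ) : ℕ := 2 * (2 ^ k - 1)

theorem stringIndex_initSeg_zero (k : ℕ) : stringIndex (initSeg (fun _ => 0) k) + 1 = 2 ^ k := by
  induction k with
  | zero => simp [initSeg, stringIndex]
  | succ k ih =>
    rw [initSeg_succ, stringIndex_concat, pow_succ, ← ih, Fin.val_zero]
    ring

theorem label_initSeg_zero (x : InfSeq 3) (k : ℕ) :
    label x (initSeg (fun _ => 0) (k + 1)) = x (zeroPos k) := by
  have h := stringIndex_initSeg_zero (k + 1)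
  rw [pow_succ] at h
  rw [label, zeroPos]
  congr 1
  omega

theorem codedFun_zero (x : InfSeq 3) : codedFun x (fun _ => 0) = eraseTwos (x ∘ zeroPos) := by
  simp only [codedFun, label_initSeg_zero, Function.comp_def]

theorem strictMono_zeroPos : StrictMono zeroPos := fun k l h => by
  have hpow : 2 ^ k < 2 ^ l := Nat.pow_lt_pow_right one_lt_two h
  have hpos := Nat.one_le_two_pow (n := k)
  unfold zeroPos
  omega

theorem primrec_zeroPos : Primrec zeroPos :=
  Primrec.nat_mul.comp (.const 2) (Primrec.nat_sub.comp
    ((Primrec₂.unpaired'.1 Nat.Primrec.pow).comp (.const 2) .id) (.const 1))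

/-- The labelling that uses the odd entries of `x` as labels, with every `1` replaced by `0` along
the path `F_x(0^ω)`, which depends only on the even entries of `x`. -/
noncomputable def recode (x : InfSeq 3) : InfSeq 3 :=
  editAlong (bitSeq (x ∘ zeroPos)) (x ∘ (2 * · + 1))

theorem strictMono_two_mul_add_one : StrictMono (2 * · + 1 : ℕ → ℕ) := fun i j h => by
  dsimp only
  omega

theorem sq_lebesgue_preimage_recode_le (W : Set (List (Fin 3))) :
    lebesgue 3 (recode ⁻¹' ⋃ σ ∈ W, cylinder σ) ^ 2 ≤ 3 * lebesgue 3 (⋃ σ ∈ W, cylinder σ) := by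
  refine sq_measure_editAlong_le (fun N v τ => ?_) W
  refine lebesgue_bitSeq_le strictMono_zeroPos.injective strictMono_two_mul_add_one.injective
    (fun i j => ?_) v τ
  unfold zeroPos
  omega

theorem three_mul_inv_two_pow_le (i : ℕ) :
    3 * (2⁻¹ : ENNReal) ^ (2 * i + 2) ≤ (2⁻¹ ^ i) ^ 2 := by
  rw [pow_add, mul_comm 2 i, pow_mul, mul_left_comm]
  refine mul_le_of_le_one_right' ?_
  rw [← ENNReal.toReal_le_toReal (ENNReal.mul_ne_top (by simp) (by simp)) (by simp)]
  norm_num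

theorem primrec_two_mul_add_one : Primrec (2 * · + 1 : ℕ → ℕ) :=
  Primrec.succ.comp (Primrec.nat_mul.comp (.const 2) .id)

theorem MLRandom.recode {x : InfSeq 3} (hx : MLRandom x) : MLRandom (recode x) := by
  let r (σ : List (Fin 3)) : List (Fin 3) :=
    editString ((subword zeroPos σ).filterMap outBit) (subword (2 * · + 1) σ)
  have hr : Primrec r :=
    primrec₂_editString.comp
      (Primrec.listFilterMap (primrec_subword primrec_zeroPos)
        ((Primrec.dom_finite outBit).comp .snd).to₂)
      (primrec_subword primrec_two_mul_add_one)
  have hcomp (y : InfSeq 3) (hy : MLRandom y) : Computes r y (RandomFun.recode y) := by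
    have hbits := computes_bitSeq
      (hy.comp_strictMono strictMono_zeroPos primrec_zeroPos).infinite_setOf_ne_two
    exact (hbits.comp (.comp_strictMono strictMono_zeroPos y)).editAlong
      (.comp_strictMono strictMono_two_mul_add_one y)
  have hg : Primrec fun i => 2 * i + 2 :=
    Primrec.nat_add.comp (Primrec.nat_mul.comp (.const 2) .id) (.const 2)
  refine hx.map hr.to_comp hcomp hg.to_comp fun i W hW => ?_
  refine (ENNReal.pow_le_pow_left_iff two_ne_zero).1 ?_
  calc _ ≤ 3 * lebesgue 3 (⋃ σ ∈ W, cylinder σ) := sq_lebesgue_preimage_recode_le W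
    _ ≤ 3 * 2⁻¹ ^ (2 * i + 2) := by gcongr
    _ ≤ (2⁻¹ ^ i) ^ 2 := three_mul_inv_two_pow_le i

theorem MLRandom.exists_eq_one_of_mem_codedFun_zero {u : InfSeq 3} (hu : MLRandom u)
    {y : InfSeq 2} (hy : y ∈ codedFun u (fun _ => 0)) : ∃ j, y j = 1 :=
  (exists_eq_one_iff_of_mem_eraseTwos (codedFun_zero u ▸ hy)).2
    ((hu.comp_strictMono strictMono_zeroPos primrec_zeroPos).exists_eq 1)

theorem MLRandom.codedFun_zero_eq_some {x : InfSeq 3} (hx : MLRandom x) :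
    codedFun x (fun _ => 0) = Part.some (bitSeq (x ∘ zeroPos)) := by
  rw [codedFun_zero, eraseTwos_eq_some_bitSeq
    (hx.comp_strictMono strictMono_zeroPos primrec_zeroPos).infinite_setOf_ne_two]

theorem not_exists_eq_one_of_mem_codedFun_editAlong {w y' : InfSeq 2} {y : InfSeq 3}
    (h : y' ∈ codedFun (editAlong w y) w) : ¬ ∃ j, y' j = 1 := fun hj => by
  obtain ⟨k, hk⟩ := (exists_eq_one_iff_of_mem_eraseTwos h).1 hj
  exact label_editAlong_ne_one w y k hk

end ZeroPath

section Composition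

theorem exists_comp_not_isRandomContinuous {F : InfSeq 2 →. InfSeq 2}
    (hF : IsRandomContinuous F) :
    ∃ G, IsRandomContinuous G ∧ ¬ IsRandomContinuous (G.comp F) := by
  obtain ⟨x, hx, rfl⟩ := hF
  refine ⟨codedFun (recode x), ⟨_, hx.recode, rfl⟩, ?_⟩
  rintro ⟨u, hu, h⟩
  have hcomp : codedFun (recode x) (bitSeq (x ∘ zeroPos)) = codedFun u (fun _ => 0) := by
    rw [← h, PFun.comp_apply, hx.codedFun_zero_eq_some]
    exact (Part.bind_some _ _).symm
  have hmem : bitSeq (u ∘ zeroPos) ∈ codedFun u (fun _ => 0) :=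
    hu.codedFun_zero_eq_some ▸ Part.mem_some _
  exact not_exists_eq_one_of_mem_codedFun_editAlong (hcomp ▸ hmem)
    (hu.exists_eq_one_of_mem_codedFun_zero hmem)

theorem exists_isRandomContinuous : ∃ F, IsRandomContinuous F := by
  obtain ⟨x, hx⟩ := (ae_mlRandom (n := 3)).exists
  exact ⟨_, x, hx, rfl⟩

end Composition

end RandomFun

theorem mainTheorem2 :
    (∀ F : RandomFun.InfSeq 2 →. RandomFun.InfSeq 2, RandomFun.IsRandomContinuous F →
      ∃ G : RandomFun.InfSeq 2 →. RandomFun.InfSeq 2,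
        RandomFun.IsRandomContinuous G ∧ ¬ RandomFun.IsRandomContinuous (G.comp F)) ∧
    ¬ (∀ F G : RandomFun.InfSeq 2 →. RandomFun.InfSeq 2,
        RandomFun.IsRandomContinuous F → RandomFun.IsRandomContinuous G →
          RandomFun.IsRandomContinuous (G.comp F)) := by
  refine ⟨fun F hF => RandomFun.exists_comp_not_isRandomContinuous hF, fun h => ?_⟩
  obtain ⟨F, hF⟩ := RandomFun.exists_isRandomContinuous
  obtain ⟨G, hG, hGF⟩ := RandomFun.exists_comp_not_isRandomContinuous hF
  exact hGF (h F G hF hG)
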